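/- Let $R$ be a (finite, crystallographic) reduced and irreducible root system in a real vector space $V$, with coroots $\beta^\vee\in V^*$, let $\Delta$ be a set of simple roots, and let $\widetilde\alpha=\sum_{\beta\in\Delta}h_\beta\beta$ be the highest root. Write its coroot as $\widetilde\alpha^\vee=\sum_{\beta\in\Delta}g_\beta\beta^\vee$ and let $g=1+\sum_{\beta\in\Delta}g_\beta$ be the dual Coxeter number. Fix $\alpha\in\Delta$. Let $\varpi_\alpha\in V$ be the fundamental weight and $\varpi_\alpha^\vee\in V^*$ the fundamental coweight of $\alpha$, so that $\varpi_\alpha(\beta^\vee)=\beta(\varpi_\alpha^\vee)=\delta_{\alpha\beta}$ for $\beta\in\Delta$. For $k>0$ let $c(\alpha,k)$ be the number of roots $\beta\in R$ with $\beta(\varpi_\alpha^\vee)=k$, and put $$i(\alpha,k)=\frac{k\,c(\alpha,k)}{\varpi_\alpha(\varpi_\alpha^\vee)},\qquad d_k(\alpha)=\sum_{\ell>0}i(\alpha,\ell k).$$ Then the sequence $d_1(\alpha),\dots,d_{h_\alpha}(\alpha)$ has the circular symmetry property with respect to $N=h_\alpha$ and $M=g h_\alpha/g_\alpha$. That is: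 the numbers $d_k(\alpha)$, $1\le k\le N$, are positive integers; $M=\sum_{k=1}^{N}\varphi(k)\,d_k(\alpha)$, where $\varphi$ is Euler's function; and whenever $r/x$ and $s/y$, written in lowest terms, are consecutive terms of the Farey sequence of order $N$ (the rational numbers in $[0,1]$ whose denominator is at most $N$, in increasing order), $$d_x(\alpha)+d_y(\alpha)=\frac{2M}{xy}=\frac{2g h_\alpha}{g_\alpha\,xy}.$$ -/

import Mathlib

noncomputable section

namespace RootPairing.Base

open Module Set

set_option linter.unusedSectionVars false

section Highest

variable {ι V V' : Type*} [Finite ι] [AddCommGroup V] [Module ℝ V] [AddCommGroup V'] [Module ℝ V']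
  {P : RootPairing ι ℝ V V'}

/-- `b.RootLE i j` says that `root j - root i` is a (possibly empty) sum of simple roots. -/
def RootLE (b : P.Base) (i j : ι) : Prop :=
  P.root j - P.root i ∈ AddSubmonoid.closure (P.root '' b.support)

/-- `θ` is (the index of) a highest root: every root is obtained from it by subtracting a sum of
simple roots. -/
def IsHighestRoot (b : P.Base) (θ : ι) : Prop := ∀ i, b.RootLE i θ

variable [P.IsCrystallographic]

lemma root_mem_closure_of_isPos (b : P.Base) {i : ι} (hi : b.IsPos i) :
    P.root i ∈ AddSubmonoid.closure (P.root '' b.support) := by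
  refine hi.induction_on_add (p := fun i => P.root i ∈ AddSubmonoid.closure (P.root '' b.support))
    (fun j hj => AddSubmonoid.subset_closure ⟨j, hj, rfl⟩) fun i j k hk hi hj => ?_
  rw [hk]
  exact add_mem hi (AddSubmonoid.subset_closure ⟨j, hj, rfl⟩)

lemma exists_rootLE_maximal (b : P.Base) (i : ι) :
    ∃ θ, b.RootLE i θ ∧ ∀ k, b.RootLE θ k → b.height k ≤ b.height θ := by
  obtain ⟨θ, h₁, h₂⟩ := Set.exists_max_image {j | b.RootLE i j} b.height (Set.toFinite _)
    ⟨i, by simp [RootLE]⟩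
  refine ⟨θ, h₁, fun k hk => h₂ k ?_⟩
  have := add_mem hk h₁
  simpa [RootLE] using this

lemma pairingIn_nonneg_of_maximal (b : P.Base) {θ : ι}
    (hθ : ∀ k, b.RootLE θ k → b.height k ≤ b.height θ) {j : ι} (hj : j ∈ b.support) :
    0 ≤ P.pairingIn ℤ θ j := by
  by_contra! h
  have hjC : P.root j ∈ AddSubmonoid.closure (P.root '' b.support) :=
    AddSubmonoid.subset_closure ⟨j, hj, rfl⟩
  by_cases hne : P.root θ = -P.root j
  · have h1 := hθ j (by simpa [RootLE, hne] using add_mem hjC hjC)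
    have h2 : b.height θ = -1 := by
      rw [P.root_eq_neg_iff.mp hne, ← height_one_of_mem_support hj]
      exact b.height_reflectionPerm_self j
    rw [h2, height_one_of_mem_support hj] at h1
    omega
  · obtain ⟨k, hk⟩ := P.root_add_root_mem_of_pairingIn_neg h hne
    have h1 := hθ k (by simpa [RootLE, hk] using hjC)
    rw [b.height_add hk, height_one_of_mem_support hj] at h1
    omega

lemma pairingIn_eq_sum (b : P.Base) {i : ι} {f : ι → ℤ}
    (hf : P.root i = ∑ l ∈ b.support, f l • P.root l) (j : ι) :
    P.pairingIn ℤ i j = ∑ l ∈ b.support, f l * P.pairingIn ℤ l j := by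
  apply FaithfulSMul.algebraMap_injective ℤ ℝ
  simp_rw [algebraMap_pairingIn, map_sum, ← root_coroot_eq_pairing, hf, map_sum, map_zsmul,
    LinearMap.coe_sum, Finset.sum_apply, LinearMap.smul_apply, root_coroot_eq_pairing,
    zsmul_eq_mul, map_mul, algebraMap_pairingIn]
  simp

variable [P.IsReduced] [P.IsIrreducible]

lemma exists_pos_coeff_of_maximal (b : P.Base) {θ : ι}
    (hθ : ∀ k, b.RootLE θ k → b.height k ≤ b.height θ) :
    ∃ f : ι → ℤ, (∀ l ∈ b.support, 0 < f l) ∧ P.root θ = ∑ l ∈ b.support, f l • P.root l := by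
  have hpos : b.IsPos θ := by
    rcases IsPos.or_neg b θ with h | h
    · exact h
    · obtain ⟨j, hj, hj'⟩ := h.exists_mem_support_pos_pairingIn
      have h1 := b.pairingIn_nonneg_of_maximal hθ hj
      rw [P.zero_lt_pairingIn_iff' ℤ] at hj'
      simp at hj'
      omega
  obtain ⟨f, hf₀, hf₁, hf₂⟩ := b.exists_root_eq_sum_int θ
  replace hf₁ : 0 < f := by
    refine hf₁.resolve_right fun h => ?_
    rw [isPos_iff, height_eq_sum hf₂] at hpos
    exact absurd hpos (not_lt.mpr (Finset.sum_nonpos fun i _ => h.le i))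
  refine ⟨f, fun l hl => ?_, hf₂⟩
  obtain ⟨i, hi⟩ := (Pi.lt_def.mp hf₁).2
  have hib : i ∈ b.support := hf₀ (by simpa using hi.ne')
  refine b.induction_on_cartanMatrix (fun l => 0 < f l) (i := ⟨i, hib⟩) (j := ⟨l, hl⟩) hi ?_
  intro i j hi hij
  by_contra! hj
  have hj0 : f j = 0 := le_antisymm hj (hf₁.le j)
  have hne : (i : ι) ≠ j := by
    intro h
    rw [h, hj0] at hi
    exact lt_irrefl _ hi
  have h1 := b.pairingIn_nonneg_of_maximal hθ j.2
  rw [b.pairingIn_eq_sum hf₂] at h1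
  have hle : ∀ l ∈ b.support, f l * P.pairingIn ℤ l j ≤ 0 := by
    intro l hl
    by_cases hlj : l = j
    · simp [hlj, hj0]
    · exact mul_nonpos_of_nonneg_of_nonpos (hf₁.le l) (b.pairingIn_le_zero_of_ne hlj hl j.2)
  have h3 : P.pairingIn ℤ i j ≠ 0 := by
    rw [ne_eq, cartanMatrix_apply_eq_zero_iff_symm] at hij
    simpa [cartanMatrix, cartanMatrixIn] using hij
  have h4 : P.pairingIn ℤ i j < 0 :=
    lt_of_le_of_ne (b.pairingIn_le_zero_of_ne hne i.2 j.2) h3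
  have := Finset.sum_lt_sum hle ⟨i, i.2, mul_neg_of_pos_of_neg hi h4⟩
  simp at this
  omega

/-- In a reduced irreducible crystallographic root system, a highest root exists. -/
lemma exists_isHighestRoot [Nonempty ι] (b : P.Base) : ∃ θ, b.IsHighestRoot θ := by
  inhabit ι
  obtain ⟨θ, -, hθ⟩ := b.exists_rootLE_maximal default
  refine ⟨θ, fun i => ?_⟩
  obtain ⟨θ', hi, hθ'⟩ := b.exists_rootLE_maximal i
  suffices θ = θ' by rwa [this]
  by_contra hne
  obtain ⟨f, hf, hfθ⟩ := b.exists_pos_coeff_of_maximal hθ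
  have hp : 0 < P.pairingIn ℤ θ θ' := by
    obtain ⟨g, hg, hgθ⟩ := b.exists_pos_coeff_of_maximal hθ'
    have hpos : b.IsPos θ' := by
      rw [isPos_iff, height_eq_sum hgθ]
      exact Finset.sum_pos hg b.support_nonempty
    obtain ⟨j, hj, hj'⟩ := hpos.exists_mem_support_pos_pairingIn
    rw [b.pairingIn_eq_sum hfθ]
    refine Finset.sum_pos' (fun l hl => mul_nonneg (hf l hl).le ?_) ⟨j, hj, mul_pos (hf j hj) hj'⟩
    have := b.pairingIn_nonneg_of_maximal hθ' hl
    by_contra! h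
    rw [P.pairingIn_lt_zero_iff ℤ] at h
    omega
  obtain ⟨k, hk⟩ := P.root_sub_root_mem_of_pairingIn_pos hp hne
  have hh := b.height_sub hk
  rcases IsPos.or_neg b k with h | h
  · have h1 := hθ' θ (by rw [RootLE, ← hk]; exact b.root_mem_closure_of_isPos h)
    rw [isPos_iff] at h
    omega
  · have h1 := hθ θ' (by
      have := b.root_mem_closure_of_isPos h
      rw [RootLE, ← neg_sub, ← hk]
      simpa using this)
    rw [isPos_iff, b.height_reflectionPerm_self] at h
    omega

end Highest

section Numbers

variable {ι V V' : Type*} [Finite ι] [AddCommGroup V] [Module ℝ V] [AddCommGroup V'] [Module ℝ V']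
  {P : RootPairing ι ℝ V V'}

/-- The (index of the) highest root. It is unique, since the simple roots are independent. -/
def highestRoot [Nonempty ι] [P.IsCrystallographic] [P.IsReduced] [P.IsIrreducible]
    (b : P.Base) : ι :=
  b.exists_isHighestRoot.choose

lemma isHighestRoot_highestRoot [Nonempty ι] [P.IsCrystallographic] [P.IsReduced]
    [P.IsIrreducible] (b : P.Base) : b.IsHighestRoot b.highestRoot :=
  b.exists_isHighestRoot.choose_spec

/-- The coefficient of the simple root `α` in the root `i`. -/
def rootCoeff (b : P.Base) (i : ι) (α : b.support) : ℤ :=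
  b.toWeightBasisInt.repr (P.rootSpanMem ℤ i) α

/-- The coefficient of the simple coroot `α^∨` in the coroot `i^∨`. -/
def corootCoeff (b : P.Base) (i : ι) (α : b.support) : ℤ :=
  b.flip.toWeightBasisInt.repr (P.flip.rootSpanMem ℤ i) α

section Coxeter

variable [Nonempty ι] [P.IsCrystallographic] [P.IsReduced] [P.IsIrreducible]

/-- The integer `h_α`: the coefficient of `α` in the highest root. -/
def coeffH (b : P.Base) (α : b.support) : ℤ := b.rootCoeff b.highestRoot α

/-- The integer `g_α`: the coefficient of `α^∨` in the coroot of the highest root. -/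
def coeffG (b : P.Base) (α : b.support) : ℤ := b.corootCoeff b.highestRoot α

/-- The dual Coxeter number `g = 1 + ∑ g_α`. -/
def dualCoxeterNumber (b : P.Base) : ℤ := 1 + ∑ α : b.support, b.coeffG α

lemma coeffH_pos (b : P.Base) (α : b.support) : 0 < b.coeffH α := by
  have key : ∀ x ∈ AddSubmonoid.closure (P.root '' b.support), ∃ hx : x ∈ P.rootSpan ℤ,
      0 ≤ b.toWeightBasisInt.repr ⟨x, hx⟩ α := by
    intro x hx
    induction hx using AddSubmonoid.closure_induction with
    | mem x hx =>
      obtain ⟨i, hi, rfl⟩ := hx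
      refine ⟨(P.rootSpanMem ℤ i).2, ?_⟩
      have h : P.rootSpanMem ℤ i = b.toWeightBasisInt ⟨i, hi⟩ := by
        apply Subtype.ext
        simp
      change 0 ≤ b.toWeightBasisInt.repr (P.rootSpanMem ℤ i) α
      rw [h, Basis.repr_self]
      classical
      rw [Finsupp.single_apply]
      split_ifs <;> simp
    | zero => exact ⟨zero_mem _, by
        change 0 ≤ b.toWeightBasisInt.repr 0 α
        simp⟩
    | add x y _ _ hx hy =>
      obtain ⟨hx, hx'⟩ := hx
      obtain ⟨hy, hy'⟩ := hy
      refine ⟨add_mem hx hy, ?_⟩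
      change 0 ≤ b.toWeightBasisInt.repr (⟨x, hx⟩ + ⟨y, hy⟩) α
      rw [map_add, Finsupp.add_apply]
      exact add_nonneg hx' hy'
  obtain ⟨hx, h⟩ := key _ (b.isHighestRoot_highestRoot α)
  have e : (⟨P.root b.highestRoot - P.root α, hx⟩ : P.rootSpan ℤ) =
      P.rootSpanMem ℤ b.highestRoot - b.toWeightBasisInt α := by
    apply Subtype.ext
    simp
  rw [e, map_sub, Basis.repr_self] at h
  simp at h
  exact lt_of_lt_of_le one_pos h

end Coxeter

variable [P.IsRootSystem]

/-- The fundamental weight `ϖ_α`, dual to the simple coroots. -/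
def fundWeight (b : P.Base) (α : b.support) : V :=
  P.toLinearMap.toPerfPair.symm (b.toCoweightBasis.coord α)

/-- The fundamental coweight `ϖ_α^∨`, dual to the simple roots. -/
def fundCoweight (b : P.Base) (α : b.support) : V' :=
  P.toLinearMap.flip.toPerfPair.symm (b.toWeightBasis.coord α)

/-- The defining property of the fundamental weights. -/
lemma fundWeight_apply_coroot (b : P.Base) (α β : b.support) :
    P.toLinearMap (b.fundWeight α) (P.coroot β) = Finsupp.single β (1 : ℝ) α := by
  rw [fundWeight, ← LinearMap.toPerfPair_apply, LinearEquiv.apply_symm_apply,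
    ← b.toCoweightBasis_apply]
  simp

/-- The defining property of the fundamental coweights. -/
lemma root_apply_fundCoweight (b : P.Base) (α β : b.support) :
    P.toLinearMap (P.root β) (b.fundCoweight α) = Finsupp.single β (1 : ℝ) α := by
  rw [fundCoweight, ← LinearMap.flip_apply, ← LinearMap.toPerfPair_apply,
    LinearEquiv.apply_symm_apply, ← b.toWeightBasis_apply]
  simp

/-- `S(α, k)`: the roots `β` with `β(ϖ_α^∨) = k`. -/
def rootLevel (b : P.Base) (α : b.support) (k : ℕ) : Set ι :=
  {i | P.toLinearMap (P.root i) (b.fundCoweight α) = k}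

/-- `c(α, k)`: the number of roots `β` with `β(ϖ_α^∨) = k`. -/
def levelCard (b : P.Base) (α : b.support) (k : ℕ) : ℕ := (b.rootLevel α k).ncard

/-- `i(α, k) = k c(α, k) / ϖ_α(ϖ_α^∨)`. -/
def levelIndex (b : P.Base) (α : b.support) (k : ℕ) : ℝ :=
  k * b.levelCard α k / P.toLinearMap (b.fundWeight α) (b.fundCoweight α)

/-- `d_k(α) = ∑_{ℓ > 0} i(α, ℓ k)`; for `k > 0` only finitely many terms are nonzero. -/
def dSeq (b : P.Base) (α : b.support) (k : ℕ) : ℝ :=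
  ∑ᶠ ℓ : ℕ+, b.levelIndex α (ℓ * k)

lemma finite_support_levelIndex (b : P.Base) (α : b.support) {k : ℕ} (hk : 0 < k) :
    (Function.support fun ℓ : ℕ+ => b.levelIndex α (ℓ * k)).Finite := by
  have hfin : (Set.range fun i => ⌊P.toLinearMap (P.root i) (b.fundCoweight α)⌋₊).Finite :=
    Set.finite_range _
  refine (hfin.preimage (f := fun ℓ : ℕ+ => (ℓ : ℕ) * k) fun x _ y _ h => ?_).subset fun ℓ hℓ => ?_
  · exact PNat.coe_injective (Nat.eq_of_mul_eq_mul_right hk h)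
  · have hne : (b.rootLevel α (ℓ * k)).Nonempty := by
      by_contra h
      rw [Set.not_nonempty_iff_eq_empty] at h
      exact hℓ (by simp [levelIndex, levelCard, h])
    obtain ⟨i, hi⟩ := hne
    refine ⟨i, ?_⟩
    have hi' : P.toLinearMap (P.root i) (b.fundCoweight α) = ((ℓ * k : ℕ) : ℝ) := hi
    simp only [hi', Nat.floor_natCast]

end Numbers

end RootPairing.Base

/-- The rational numbers in `[0, 1]` whose denominator in lowest terms is at most `N`. -/
def fareySet (N : ℕ) : Set ℚ := {q | 0 ≤ q ∧ q ≤ 1 ∧ q.den ≤ N}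

/-- `p < q` are consecutive terms of the Farey sequence of order `N`. -/
def FareyConsecutive (N : ℕ) (p q : ℚ) : Prop :=
  p ∈ fareySet N ∧ q ∈ fareySet N ∧ p < q ∧ ∀ t ∈ fareySet N, ¬ (p < t ∧ t < q)

/-- The sequence `d 1, …, d N` of positive integers (given as real numbers), for which
`M = ∑ φ(k) d k`, has the circular symmetry property with respect to `N` and `M`. -/
structure HasCircularSymmetry (d : ℕ → ℝ) (N : ℕ) (M : ℝ) : Prop where
  pos_integer : ∀ k, 1 ≤ k → k ≤ N → ∃ m : ℕ, 0 < m ∧ d k = m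
  sum_totient : M = ∑ k ∈ Finset.Icc 1 N, (Nat.totient k : ℝ) * d k
  add_eq : ∀ p q : ℚ, FareyConsecutive N p q →
    d p.den + d q.den = 2 * M / ((p.den : ℝ) * (q.den : ℝ))

end

/-!
The whole argument takes place in sums of the form `v = ∑ F(n_β) β` over all roots `β`, where `n_β`,
the *level* of `β`, is the coefficient of `α` in `β`. The reflections in the simple roots other than
`α` preserve levels, so `v` is a multiple of `ϖ_α` (`sum_smul_root_eq_smul_fundWeight`), and
evaluating at `ϖ_α^∨` identifies the factor. Three choices of `F` give everything.

* The indicator of level `k`: `i(α, k)` is the sum of the integers `⟨β, α^∨⟩` over the roots of level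
  `k`, so the `d_k` are integers. They are positive for `k ≤ h_α` because no level up to `h_α` is
  empty (`exists_rootCoeff_eq`).

* The identity: the canonical form `B(x, y) = ∑ β(x) β(y)` satisfies `B(x, ϖ_α^∨) = c ϖ_α(x)` with
  `c = ½ B(α^∨, α^∨)`. Evaluating at `x = θ^∨`, for `θ` the highest root, gives
  `c = 2 g h_α / g_α = 2 M`, because `B(θ^∨, θ^∨) = 4 g` (`corootForm_coroot_highestRoot`): every
  positive root `β ≠ θ` has `⟨β, θ^∨⟩ ∈ {0, 1}`, and `⟨2ρ, θ^∨⟩ = 2 (g - 1)`. Evaluating at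
  `x = ϖ_α^∨` gives `∑ n i(α, n) = M` (`sum_mul_levelIndex`), which is the totient sum by
  `∑_{k ∣ n} φ(k) = n`.

* The sawtooth function `((n p))`, for `p = r / x` with `x ≤ h_α`: there is a root `γ` of level `x`,
  and the reflection in `γ` changes each `n_β p` by an integer, so `v` is also killed by `γ^∨`. As
  `ϖ_α(γ^∨) ≠ 0`, this forces `v = 0`, hence `∑ i(α, n) ((n p)) = 0` (`sum_levelIndex_mul_sawtooth`).

Let `p = r / x < q = s / y` be consecutive in the Farey sequence of order `h_α`. No fraction `m / n`
with `n ≤ h_α` lies strictly between them, so `((n q)) - ((n p))` is `n (q - p)` minus half a jump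
for each of `x`, `y` that divides `n`. Subtracting the vanishing sums at `p` and `q` yields
`M (q - p) = (d_x + d_y) / 2`, and `q - p = 1 / (x y)`.
-/

namespace RootPairing.Base

open Module Set

set_option linter.unusedSectionVars false

variable {ι V V' : Type*} [AddCommGroup V] [Module ℝ V] [AddCommGroup V'] [Module ℝ V']
  {P : RootPairing ι ℝ V V'}

/-! ### Coordinates of roots and coroots in simple roots and simple coroots -/

section Finite

variable [Finite ι]

lemma root_eq_sum_rootCoeff (b : P.Base) (i : ι) :
    P.root i = ∑ β : b.support, b.rootCoeff i β • P.root β := by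
  have h := congrArg (Submodule.subtype _) (b.toWeightBasisInt.sum_repr (P.rootSpanMem ℤ i))
  simpa [rootCoeff] using h.symm

lemma coroot_eq_sum_corootCoeff (b : P.Base) (i : ι) :
    P.coroot i = ∑ β : b.support, b.corootCoeff i β • P.coroot β :=
  b.flip.root_eq_sum_rootCoeff i

lemma root_ext_rootCoeff (b : P.Base) {i j : ι} (h : ∀ β, b.rootCoeff i β = b.rootCoeff j β) :
    i = j := by
  apply P.root.injective
  rw [b.root_eq_sum_rootCoeff i, b.root_eq_sum_rootCoeff j]
  simp [h]

lemma rootCoeff_of_root_eq_sub_zsmul (b : P.Base) {i j k : ι} {m : ℤ}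
    (h : P.root k = P.root i - m • P.root j) (β : b.support) :
    b.rootCoeff k β = b.rootCoeff i β - m * b.rootCoeff j β := by
  have e : P.rootSpanMem ℤ k = P.rootSpanMem ℤ i - m • P.rootSpanMem ℤ j := by
    apply Subtype.ext
    simpa using h
  rw [rootCoeff, e, map_sub, map_zsmul, Finsupp.sub_apply, Finsupp.smul_apply, smul_eq_mul]
  rfl

lemma rootCoeff_support [DecidableEq ι] (b : P.Base) (β γ : b.support) :
    b.rootCoeff β γ = if β = γ then 1 else 0 := by
  have h : P.rootSpanMem ℤ β = b.toWeightBasisInt β := by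
    apply Subtype.ext
    simp
  rw [rootCoeff, h, Basis.repr_self, Finsupp.single_apply]

@[simp] lemma rootCoeff_self (b : P.Base) (β : b.support) : b.rootCoeff β β = 1 := by
  classical
  simp [rootCoeff_support]

lemma rootCoeff_of_ne (b : P.Base) {β γ : b.support} (h : β ≠ γ) : b.rootCoeff β γ = 0 := by
  classical
  simp [rootCoeff_support, h]

lemma rootCoeff_reflectionPerm [P.IsCrystallographic] (b : P.Base) (i j : ι) (β : b.support) :
    b.rootCoeff (P.reflectionPerm j i) β =
      b.rootCoeff i β - P.pairingIn ℤ i j * b.rootCoeff j β := by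
  apply b.rootCoeff_of_root_eq_sub_zsmul
  rw [root_reflectionPerm, reflection_apply_root' ℤ]

lemma rootCoeff_neg (b : P.Base) (i : ι) (β : b.support) :
    b.rootCoeff (P.reflectionPerm i i) β = -b.rootCoeff i β := by
  have := b.rootCoeff_of_root_eq_sub_zsmul (i := i) (j := i) (k := P.reflectionPerm i i) (m := 2)
    (by rw [root_reflectionPerm, reflection_apply_self]; module) β
  rw [this]; ring

lemma RootLE.rootCoeff_le {b : P.Base} {i j : ι} (h : b.RootLE i j) (β : b.support) :
    b.rootCoeff i β ≤ b.rootCoeff j β := by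
  have key : ∀ x ∈ AddSubmonoid.closure (P.root '' b.support), ∃ hx : x ∈ P.rootSpan ℤ,
      0 ≤ b.toWeightBasisInt.repr ⟨x, hx⟩ β := by
    intro x hx
    induction hx using AddSubmonoid.closure_induction with
    | mem x hx =>
      obtain ⟨i, hi, rfl⟩ := hx
      refine ⟨(P.rootSpanMem ℤ i).2, ?_⟩
      change 0 ≤ b.rootCoeff (⟨i, hi⟩ : b.support) β
      classical
      rw [rootCoeff_support]
      split_ifs <;> simp
    | zero => exact ⟨zero_mem _, by
        change 0 ≤ b.toWeightBasisInt.repr 0 β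
        simp⟩
    | add x y _ _ hx hy =>
      obtain ⟨hx, hx'⟩ := hx
      obtain ⟨hy, hy'⟩ := hy
      refine ⟨add_mem hx hy, ?_⟩
      change 0 ≤ b.toWeightBasisInt.repr (⟨x, hx⟩ + ⟨y, hy⟩) β
      rw [map_add, Finsupp.add_apply]
      exact add_nonneg hx' hy'
  obtain ⟨hx, h⟩ := key _ h
  have e : (⟨P.root j - P.root i, hx⟩ : P.rootSpan ℤ) =
      P.rootSpanMem ℤ j - P.rootSpanMem ℤ i := by
    apply Subtype.ext
    simp
  rw [e, map_sub, Finsupp.sub_apply] at h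
  exact sub_nonneg.mp h

lemma IsPos.rootCoeff_nonneg [P.IsCrystallographic] {b : P.Base} {i : ι} (hi : b.IsPos i)
    (β : b.support) : 0 ≤ b.rootCoeff i β := by
  have hi' := b.root_mem_closure_of_isPos hi
  have h := RootLE.rootCoeff_le (b := b) (i := P.reflectionPerm i i) (j := i) (by
    rw [RootLE, root_reflectionPerm, reflection_apply_self, sub_neg_eq_add]
    exact add_mem hi' hi') β
  rw [rootCoeff_neg] at h
  omega

lemma isPos_neg_iff (b : P.Base) (i : ι) : b.IsPos (P.reflectionPerm i i) ↔ ¬ b.IsPos i :=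
  IsPos.neg_iff_not b i

end Finite

section HighestRoot

variable [Finite ι] [Nonempty ι] [P.IsCrystallographic] [P.IsReduced] [P.IsIrreducible]

lemma rootCoeff_le_coeffH (b : P.Base) (i : ι) (β : b.support) :
    b.rootCoeff i β ≤ b.coeffH β :=
  RootLE.rootCoeff_le (b.isHighestRoot_highestRoot i) β

lemma neg_coeffH_le_rootCoeff (b : P.Base) (i : ι) (β : b.support) :
    -b.coeffH β ≤ b.rootCoeff i β := by
  have := b.rootCoeff_le_coeffH (P.reflectionPerm i i) β
  rw [rootCoeff_neg] at this
  omega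

lemma isPos_highestRoot (b : P.Base) : b.IsPos b.highestRoot := by
  by_contra h
  rw [← isPos_neg_iff] at h
  obtain ⟨j, hj⟩ := b.support_nonempty
  have h1 := h.rootCoeff_nonneg ⟨j, hj⟩
  rw [rootCoeff_neg] at h1
  have h2 := b.coeffH_pos ⟨j, hj⟩
  rw [coeffH] at h2
  omega

/-- If `β` is positive and `m = ⟨β, θ^∨⟩`, all coefficients of the root `β - m θ` lie between those
of `-θ` and `θ`; this leaves only `m = 0` and `m = 1`. -/
lemma IsPos.pairingIn_highestRoot {b : P.Base} {i : ι} (hi : b.IsPos i)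
    (hne : i ≠ b.highestRoot) :
    P.pairingIn ℤ i b.highestRoot = 0 ∨ P.pairingIn ℤ i b.highestRoot = 1 := by
  set m := P.pairingIn ℤ i b.highestRoot with hm
  have hr (β : b.support) :
      b.rootCoeff (P.reflectionPerm b.highestRoot i) β = b.rootCoeff i β - m * b.coeffH β :=
    b.rootCoeff_reflectionPerm i _ β
  have h0 : 0 ≤ m := by
    by_contra! hlt
    have hz (β : b.support) : b.rootCoeff i β = 0 := by
      have h1 := b.rootCoeff_le_coeffH (P.reflectionPerm b.highestRoot i) β
      have h2 := hi.rootCoeff_nonneg β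
      have h3 := b.coeffH_pos β
      rw [hr] at h1
      nlinarith
    apply P.ne_zero i
    rw [b.root_eq_sum_rootCoeff i]
    simp [hz]
  have h1 : m ≤ 1 := by
    by_contra! hlt
    refine hne (b.root_ext_rootCoeff fun β => le_antisymm (b.rootCoeff_le_coeffH i β) ?_)
    have h1 := b.neg_coeffH_le_rootCoeff (P.reflectionPerm b.highestRoot i) β
    have h3 := b.coeffH_pos β
    rw [hr] at h1
    change b.coeffH β ≤ _
    nlinarith
  omega

/-- Every value between `1` and the maximal one occurs as the coefficient of `α` in a root, since a
positive root is reached by adding simple roots one at a time. -/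
lemma exists_rootCoeff_eq (b : P.Base) (α : b.support) {k : ℤ} (h1 : 1 ≤ k)
    (hk : k ≤ b.coeffH α) : ∃ i, b.rootCoeff i α = k := by
  refine b.isPos_highestRoot.induction_on_add
    (p := fun i => ∀ k, 1 ≤ k → k ≤ b.rootCoeff i α → ∃ j, b.rootCoeff j α = k)
    (fun j hj k h1 hk => ⟨j, ?_⟩) (fun i j k hk ih hj m h1 hm => ?_) k h1 hk
  · classical
    have := b.rootCoeff_support ⟨j, hj⟩ α
    simp only at this
    rw [this] at hk ⊢
    split_ifs at * <;> omega
  · by_cases hmi : m ≤ b.rootCoeff i α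
    · exact ih m h1 hmi
    · refine ⟨k, ?_⟩
      have h2 := b.rootCoeff_of_root_eq_sub_zsmul (i := i) (j := j) (k := k) (m := -1)
        (by rw [hk]; module) α
      classical
      have := b.rootCoeff_support ⟨j, hj⟩ α
      simp only at this
      rw [this] at h2
      split_ifs at * <;> omega

end HighestRoot

/-! ### Evaluation at fundamental weights and coweights -/

section Fundamental

variable [Finite ι] [P.IsRootSystem]

lemma root_apply_fundCoweight_eq_rootCoeff (b : P.Base) (α : b.support) (i : ι) :
    P.toLinearMap (P.root i) (b.fundCoweight α) = b.rootCoeff i α := by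
  classical
  rw [b.root_eq_sum_rootCoeff i]
  simp [root_apply_fundCoweight, Finsupp.single_apply]

lemma fundWeight_apply_coroot_eq_corootCoeff (b : P.Base) (α : b.support) (i : ι) :
    P.toLinearMap (b.fundWeight α) (P.coroot i) = b.corootCoeff i α := by
  classical
  rw [b.coroot_eq_sum_corootCoeff i]
  simp [fundWeight_apply_coroot, Finsupp.single_apply]

/-- A vector killed by all simple coroots but `α^∨` is a multiple of the fundamental weight. -/
lemma eq_smul_fundWeight (b : P.Base) (α : b.support) {v : V}
    (hv : ∀ β : b.support, β ≠ α → P.toLinearMap v (P.coroot β) = 0) :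
    v = P.toLinearMap v (P.coroot α) • b.fundWeight α := by
  apply P.toLinearMap.toPerfPair.injective
  refine b.toCoweightBasis.ext fun β => ?_
  classical
  simp only [LinearMap.toPerfPair_apply, toCoweightBasis_apply, map_smul, LinearMap.smul_apply,
    fundWeight_apply_coroot, Finsupp.single_apply]
  split_ifs with h
  · simp [h]
  · simp [hv β h]

end Fundamental

/-! ### Weighted sums of roots -/

section WeightedSums

variable [Fintype ι]

/-- If the weights are invariant under the reflection in `j`, so is the weighted sum of the roots,
and hence `j^∨` vanishes on it. -/
lemma toLinearMap_sum_smul_root_coroot_eq_zero (P : RootPairing ι ℝ V V') (f : ι → ℝ) (j : ι)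
    (hf : ∀ i, f (P.reflectionPerm j i) = f i) :
    P.toLinearMap (∑ i, f i • P.root i) (P.coroot j) = 0 := by
  have h : P.toLinearMap (∑ i, f i • P.root i) (P.coroot j) = ∑ i, f i * P.pairing i j := by
    simp
  have h2 : ∑ i, f i * P.pairing i j = -∑ i, f i * P.pairing i j := by
    conv_lhs => rw [← Equiv.sum_comp (P.reflectionPerm j)]
    rw [← Finset.sum_neg_distrib]
    refine Finset.sum_congr rfl fun i _ => ?_
    rw [hf, ← pairing_reflectionPerm, pairing_reflectionPerm_self_right]
    ring
  rw [h]
  linarith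

/-- `B(j^∨, x) = ½ B(j^∨, j^∨) ⟨j, x⟩` for the canonical form `B`. -/
lemma corootForm_coroot_apply (P : RootPairing ι ℝ V V') (j : ι) (x : V') :
    P.CorootForm (P.coroot j) x =
      P.CorootForm (P.coroot j) (P.coroot j) / 2 * P.toLinearMap (P.root j) x := by
  have h := congrArg (fun v => P.toLinearMap v x) (P.corootForm_self_smul_root j)
  simp only [map_smul, LinearMap.smul_apply, smul_eq_mul, map_nsmul,
    toLinearMap_apply_CoPolarization, nsmul_eq_mul, Nat.cast_ofNat] at h
  linarith

lemma corootForm_coroot_self_pos (P : RootPairing ι ℝ V V') (j : ι) :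
    0 < P.CorootForm (P.coroot j) (P.coroot j) := by
  rw [corootForm_apply_apply]
  refine Finset.sum_pos' (fun i _ => mul_self_nonneg _) ⟨j, Finset.mem_univ _, ?_⟩
  simp

variable [P.IsRootSystem] [P.IsCrystallographic]

/-- The vector `∑ F(n_i) i`, where `n_i` is the coefficient of `α` in the root `i`, is a multiple of
the fundamental weight: the reflections in the other simple roots preserve `n_i`. -/
lemma sum_smul_root_eq_smul_fundWeight (b : P.Base) (α : b.support) (F : ℤ → ℝ) :
    ∑ i, F (b.rootCoeff i α) • P.root i =
      (∑ i, F (b.rootCoeff i α) * P.pairing i α) • b.fundWeight α := by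
  rw [b.eq_smul_fundWeight α (v := ∑ i, F (b.rootCoeff i α) • P.root i) fun β hβ => ?_]
  · simp
  · refine toLinearMap_sum_smul_root_coroot_eq_zero P _ _ fun i => ?_
    rw [rootCoeff_reflectionPerm, rootCoeff_of_ne b hβ, mul_zero, sub_zero]

lemma sum_mul_rootCoeff (b : P.Base) (α : b.support) (F : ℤ → ℝ) :
    ∑ i, F (b.rootCoeff i α) * b.rootCoeff i α = (∑ i, F (b.rootCoeff i α) * P.pairing i α) *
      P.toLinearMap (b.fundWeight α) (b.fundCoweight α) := by
  have h := congrArg (fun v => P.toLinearMap v (b.fundCoweight α))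
    (b.sum_smul_root_eq_smul_fundWeight α F)
  simpa [root_apply_fundCoweight_eq_rootCoeff] using h

/-- Under the canonical form `B`, the coweight `ϖ_α^∨` corresponds to `½ B(α^∨, α^∨) ϖ_α`. -/
lemma corootForm_fundCoweight (b : P.Base) (α : b.support) (x : V') :
    P.CorootForm x (b.fundCoweight α) =
      P.CorootForm (P.coroot α) (P.coroot α) / 2 * P.toLinearMap (b.fundWeight α) x := by
  have h := congrArg (fun v => P.toLinearMap v x)
    (b.sum_smul_root_eq_smul_fundWeight α (fun n => (n : ℝ)))
  have hα := corootForm_coroot_apply P α (b.fundCoweight α)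
  rw [root_apply_fundCoweight_eq_rootCoeff, rootCoeff_self, corootForm_apply_apply] at hα
  simp only [map_sum, map_smul, LinearMap.smul_apply, LinearMap.sum_apply, smul_eq_mul] at h
  rw [corootForm_apply_apply]
  simp only [root', root_apply_fundCoweight_eq_rootCoeff, root_coroot_eq_pairing] at hα ⊢
  simp only [mul_comm (P.pairing _ _)] at hα
  rw [hα] at h
  simp only [mul_comm (P.toLinearMap (P.root _) _)]
  rw [h]
  simp

lemma sum_rootCoeff_sq (b : P.Base) (α : b.support) :
    ∑ i, (b.rootCoeff i α : ℝ) ^ 2 = P.CorootForm (P.coroot α) (P.coroot α) / 2 *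
      P.toLinearMap (b.fundWeight α) (b.fundCoweight α) := by
  rw [← corootForm_fundCoweight, corootForm_apply_apply]
  simp [root', root_apply_fundCoweight_eq_rootCoeff, sq]

lemma fundWeight_apply_fundCoweight_pos (b : P.Base) (α : b.support) :
    0 < P.toLinearMap (b.fundWeight α) (b.fundCoweight α) := by
  have h : 0 < ∑ i, (b.rootCoeff i α : ℝ) ^ 2 :=
    Finset.sum_pos' (fun i _ => sq_nonneg _) ⟨α, Finset.mem_univ _, by simp⟩
  rw [sum_rootCoeff_sq] at h
  exact pos_of_mul_pos_right h (half_pos (corootForm_coroot_self_pos P α)).le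

/-- The coefficient of `α^∨` in a coroot is a positive multiple of the coefficient of `α` in the
root. -/
lemma corootForm_mul_rootCoeff (b : P.Base) (α : b.support) (j : ι) :
    P.CorootForm (P.coroot j) (P.coroot j) * b.rootCoeff j α =
      P.CorootForm (P.coroot α) (P.coroot α) * b.corootCoeff j α := by
  have h := corootForm_coroot_apply P j (b.fundCoweight α)
  rw [corootForm_fundCoweight, root_apply_fundCoweight_eq_rootCoeff,
    fundWeight_apply_coroot_eq_corootCoeff] at h
  linarith

end WeightedSums

/-! ### The dual Coxeter number and the canonical form -/

lemma intCast_pairingIn (P : RootPairing ι ℝ V V') [P.IsCrystallographic] (i j : ι) :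
    ((P.pairingIn ℤ i j : ℤ) : ℝ) = P.pairing i j :=
  P.algebraMap_pairingIn ℤ i j

section DualCoxeter

variable [Fintype ι] [P.IsCrystallographic] [P.IsReduced]

/-- `2ρ` takes the value `2` at every simple coroot: the reflection in a simple root `j` permutes
the positive roots other than `j`. -/
lemma sum_pairingIn_of_isPos [DecidableEq ι] (b : P.Base) [DecidablePred b.IsPos] {j : ι}
    (hj : j ∈ b.support) : ∑ i with b.IsPos i, P.pairingIn ℤ i j = 2 := by
  have hjp : j ∈ Finset.univ.filter b.IsPos := by simpa using isPos_of_mem_support hj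
  rw [← Finset.add_sum_erase _ _ hjp]
  have h0 : ∑ i ∈ (Finset.univ.filter b.IsPos).erase j, P.pairingIn ℤ i j = 0 := by
    have hneg (i : ι) : P.pairingIn ℤ (P.reflectionPerm j i) j = -P.pairingIn ℤ i j := by
      apply Int.cast_injective (α := ℝ)
      rw [Int.cast_neg, intCast_pairingIn, intCast_pairingIn, ← pairing_reflectionPerm,
        pairing_reflectionPerm_self_right]
    refine Finset.sum_involution (fun i _ => P.reflectionPerm j i) ?_ ?_ ?_ ?_
    · intro i _
      rw [hneg]; ring
    · intro i _ hi h
      have := hneg i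
      rw [h] at this
      omega
    · intro i hi
      simp only [Finset.mem_erase, Finset.mem_filter, Finset.mem_univ, true_and] at hi ⊢
      refine ⟨fun h => ?_, hi.2.reflectionPerm hj hi.1⟩
      have h2 := P.reflectionPerm_self j i
      rw [h] at h2
      rw [← h2, isPos_neg_iff] at hi
      exact hi.2 (isPos_of_mem_support hj)
    · intro i _
      exact P.reflectionPerm_self j i
  rw [h0, pairingIn_same]
  rfl

variable [Nonempty ι] [P.IsIrreducible]

/-- The squares `⟨β, θ^∨⟩²` over the positive roots sum to `2g`. They agree with `⟨β, θ^∨⟩` except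
at `β = θ`, and `⟨2ρ, θ^∨⟩ = 2 (g - 1)`. -/
lemma sum_pairingIn_highestRoot_sq [DecidableEq ι] (b : P.Base) [DecidablePred b.IsPos] :
    ∑ i with b.IsPos i, P.pairingIn ℤ i b.highestRoot ^ 2 = 2 * b.dualCoxeterNumber := by
  have h1 : ∑ i with b.IsPos i, P.pairingIn ℤ i b.highestRoot = 2 * (b.dualCoxeterNumber - 1) := by
    have h (i : ι) : P.pairingIn ℤ i b.highestRoot =
        ∑ β : b.support, b.coeffG β * P.pairingIn ℤ i β := by
      apply Int.cast_injective (α := ℝ)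
      rw [intCast_pairingIn, ← root_coroot_eq_pairing, b.coroot_eq_sum_corootCoeff b.highestRoot]
      simp [coeffG, intCast_pairingIn]
    simp_rw [h]
    rw [Finset.sum_comm]
    simp_rw [← Finset.mul_sum, sum_pairingIn_of_isPos b (Subtype.prop _)]
    rw [← Finset.sum_mul, dualCoxeterNumber]
    ring
  have hθ : b.highestRoot ∈ Finset.univ.filter b.IsPos := by simpa using b.isPos_highestRoot
  rw [← Finset.add_sum_erase _ _ hθ, pairingIn_same] at h1 ⊢
  have h2 : ∑ i ∈ (Finset.univ.filter b.IsPos).erase b.highestRoot,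
      P.pairingIn ℤ i b.highestRoot ^ 2 =
      ∑ i ∈ (Finset.univ.filter b.IsPos).erase b.highestRoot,
        P.pairingIn ℤ i b.highestRoot := by
    refine Finset.sum_congr rfl fun i hi => ?_
    simp only [Finset.mem_erase, Finset.mem_filter, Finset.mem_univ, true_and] at hi
    rcases hi.2.pairingIn_highestRoot hi.1 with h | h <;> simp [h]
  rw [h2]
  linarith

lemma corootForm_coroot_highestRoot (b : P.Base) :
    P.CorootForm (P.coroot b.highestRoot) (P.coroot b.highestRoot) =
      4 * (b.dualCoxeterNumber : ℝ) := by
  classical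
  have h := b.sum_pairingIn_highestRoot_sq
  have hneg : ∑ i with ¬ b.IsPos i, P.pairingIn ℤ i b.highestRoot ^ 2 =
      ∑ i with b.IsPos i, P.pairingIn ℤ i b.highestRoot ^ 2 := by
    refine Finset.sum_nbij' (fun i => P.reflectionPerm i i) (fun i => P.reflectionPerm i i)
      ?_ ?_ ?_ ?_ ?_
    · intro i hi
      simpa [isPos_neg_iff] using hi
    · intro i hi
      simpa [isPos_neg_iff] using hi
    · intro i _
      exact P.indexNeg.neg_neg i
    · intro i _
      exact P.indexNeg.neg_neg i
    · intro i _
      have : P.pairingIn ℤ (P.reflectionPerm i i) b.highestRoot =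
          -P.pairingIn ℤ i b.highestRoot := by
        apply Int.cast_injective (α := ℝ)
        rw [Int.cast_neg, intCast_pairingIn, intCast_pairingIn, pairing_reflectionPerm_self_left]
      rw [this, neg_sq]
  have hall : ∑ i, P.pairingIn ℤ i b.highestRoot ^ 2 = 4 * b.dualCoxeterNumber := by
    rw [← Finset.sum_filter_add_sum_filter_not Finset.univ b.IsPos, hneg, h]
    ring
  rw [corootForm_apply_apply]
  have hall' := congrArg (Int.cast : ℤ → ℝ) hall
  push_cast [intCast_pairingIn] at hall'
  simpa [sq] using hall'

variable [P.IsRootSystem]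

/-- `½ B(α^∨, α^∨) = 2 g h_α / g_α` for the canonical form `B`. -/
lemma corootForm_coroot_self (b : P.Base) (α : b.support) :
    P.CorootForm (P.coroot α) (P.coroot α) / 2 =
      2 * ((b.dualCoxeterNumber : ℝ) * b.coeffH α / b.coeffG α) := by
  have h := b.corootForm_mul_rootCoeff α b.highestRoot
  have hθ := corootForm_coroot_self_pos P b.highestRoot
  have hH : (0 : ℝ) < b.coeffH α := by exact_mod_cast b.coeffH_pos α
  change _ * (b.coeffH α : ℝ) = _ * (b.coeffG α : ℝ) at h
  have hG : (b.coeffG α : ℝ) ≠ 0 := by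
    intro h0
    rw [h0, mul_zero] at h
    exact (mul_pos hθ hH).ne' h
  rw [corootForm_coroot_highestRoot] at h
  field_simp
  linarith

end DualCoxeter

/-! ### Sums over the levels of the roots -/

section Levels

variable [Fintype ι] [P.IsRootSystem]

lemma mem_rootLevel (b : P.Base) (α : b.support) (k : ℕ) (i : ι) :
    i ∈ b.rootLevel α k ↔ b.rootCoeff i α = k := by
  rw [rootLevel, Set.mem_ofPred_eq, root_apply_fundCoweight_eq_rootCoeff]
  norm_cast

lemma levelCard_eq_card (b : P.Base) (α : b.support) (k : ℕ) :
    b.levelCard α k = (Finset.univ.filter fun i => b.rootCoeff i α = k).card := by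
  rw [levelCard, ← Set.ncard_coe_finset]
  congr 1
  ext i
  simp [mem_rootLevel]

section Crystallographic

variable [P.IsCrystallographic]

/-- `i(α, k)` is the sum of the numbers `⟨β, α^∨⟩` over the roots `β` of level `k`. -/
lemma levelIndex_eq_sum (b : P.Base) (α : b.support) (k : ℕ) :
    b.levelIndex α k = ((∑ i with b.rootCoeff i α = k, P.pairingIn ℤ i α : ℤ) : ℝ) := by
  have h := b.sum_mul_rootCoeff α (fun n => if n = k then 1 else 0)
  have hpos := b.fundWeight_apply_fundCoweight_pos α
  rw [levelIndex, div_eq_iff hpos.ne', levelCard_eq_card]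
  simp only [ite_mul, one_mul, zero_mul, ← Finset.sum_filter] at h
  push_cast [intCast_pairingIn]
  rw [← h, Finset.sum_congr rfl (g := fun _ => (k : ℝ))]
  · rw [Finset.sum_const, nsmul_eq_mul, mul_comm]
  · intro i hi
    simp only [Finset.mem_filter] at hi
    rw [hi.2]
    simp

lemma levelIndex_nonneg (b : P.Base) (α : b.support) (k : ℕ) : 0 ≤ b.levelIndex α k :=
  div_nonneg (by positivity) (b.fundWeight_apply_fundCoweight_pos α).le

end Crystallographic

variable [Nonempty ι] [P.IsCrystallographic] [P.IsReduced] [P.IsIrreducible]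

lemma levelIndex_pos (b : P.Base) (α : b.support) {k : ℕ} (h1 : 1 ≤ k)
    (hk : k ≤ (b.coeffH α).toNat) : 0 < b.levelIndex α k := by
  obtain ⟨i, hi⟩ := b.exists_rootCoeff_eq α (k := k) (by omega) (by omega)
  have hc : 0 < b.levelCard α k := by
    rw [levelCard_eq_card]
    exact Finset.card_pos.mpr ⟨i, by simpa using hi⟩
  have := b.fundWeight_apply_fundCoweight_pos α
  rw [levelIndex]
  positivity

lemma levelIndex_eq_zero (b : P.Base) (α : b.support) {k : ℕ} (hk : (b.coeffH α).toNat < k) :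
    b.levelIndex α k = 0 := by
  have hc : b.levelCard α k = 0 := by
    rw [levelCard_eq_card, Finset.card_eq_zero, Finset.filter_eq_empty_iff]
    intro i _ hi
    have := b.rootCoeff_le_coeffH i α
    omega
  simp [levelIndex, hc]

/-- An even function of the level, vanishing at `0`, is summed over the roots level by level. -/
lemma sum_rootCoeff_eq_sum_levelCard (b : P.Base) (α : b.support) (F : ℤ → ℝ)
    (hF : ∀ n, F (-n) = F n) (h0 : F 0 = 0) :
    ∑ i, F (b.rootCoeff i α) =
      2 * ∑ n ∈ Finset.Icc 1 (b.coeffH α).toNat, b.levelCard α n * F n := by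
  have hpos : ∑ i with 0 < b.rootCoeff i α, F (b.rootCoeff i α) =
      ∑ n ∈ Finset.Icc 1 (b.coeffH α).toNat, b.levelCard α n * F n := by
    rw [← Finset.sum_fiberwise_of_maps_to (s := Finset.univ.filter fun i => 0 < b.rootCoeff i α)
      (t := Finset.Icc 1 (b.coeffH α).toNat) (g := fun i => (b.rootCoeff i α).toNat)]
    · refine Finset.sum_congr rfl fun n hn => ?_
      rw [Finset.mem_Icc] at hn
      rw [levelCard_eq_card, Finset.filter_filter, ← nsmul_eq_mul, ← Finset.sum_const]
      refine Finset.sum_congr (Finset.filter_congr fun i _ => ?_) fun i hi => ?_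
      · omega
      · rw [Finset.mem_filter] at hi
        rw [hi.2]
    · intro i hi
      have := b.rootCoeff_le_coeffH i α
      rw [Finset.mem_filter] at hi
      rw [Finset.mem_Icc]
      omega
  have hneg : ∑ i with ¬ 0 < b.rootCoeff i α, F (b.rootCoeff i α) =
      ∑ i with 0 < b.rootCoeff i α, F (b.rootCoeff i α) := by
    have h1 : ∑ i with ¬ 0 < b.rootCoeff i α, F (b.rootCoeff i α) =
        ∑ i with b.rootCoeff i α < 0, F (b.rootCoeff i α) := by
      symm
      refine Finset.sum_subset (fun i hi => ?_) fun i hi hi' => ?_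
      · simp only [Finset.mem_filter, Finset.mem_univ, true_and] at hi ⊢
        omega
      · simp only [Finset.mem_filter, Finset.mem_univ, true_and] at hi hi'
        rw [show b.rootCoeff i α = 0 by omega, h0]
    rw [h1]
    refine Finset.sum_nbij' (fun i => P.reflectionPerm i i) (fun i => P.reflectionPerm i i)
      ?_ ?_ ?_ ?_ ?_
    · intro i hi
      simpa [rootCoeff_neg] using hi
    · intro i hi
      simpa [rootCoeff_neg] using hi
    · intro i _
      exact P.indexNeg.neg_neg i
    · intro i _
      exact P.indexNeg.neg_neg i
    · intro i _
      rw [rootCoeff_neg, hF]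
  rw [← Finset.sum_filter_add_sum_filter_not Finset.univ (fun i => 0 < b.rootCoeff i α), hneg, hpos]
  ring

lemma sum_mul_levelIndex (b : P.Base) (α : b.support) :
    ∑ n ∈ Finset.Icc 1 (b.coeffH α).toNat, n * b.levelIndex α n =
      (b.dualCoxeterNumber : ℝ) * b.coeffH α / b.coeffG α := by
  have h := b.sum_rootCoeff_eq_sum_levelCard α (fun n => (n : ℝ) ^ 2) (by simp) (by simp)
  have hpos := b.fundWeight_apply_fundCoweight_pos α
  rw [sum_rootCoeff_sq, corootForm_coroot_self] at h
  have h2 : ∑ n ∈ Finset.Icc 1 (b.coeffH α).toNat, n * b.levelIndex α n =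
      (∑ n ∈ Finset.Icc 1 (b.coeffH α).toNat, b.levelCard α n * ((n : ℤ) : ℝ) ^ 2) /
        P.toLinearMap (b.fundWeight α) (b.fundCoweight α) := by
    rw [Finset.sum_div]
    refine Finset.sum_congr rfl fun n _ => ?_
    rw [levelIndex]
    push_cast
    ring
  rw [h2, div_eq_iff hpos.ne']
  linarith

end Levels

end RootPairing.Base

/-! ### Consecutive Farey fractions and the sawtooth function -/

/-- Consecutive terms of a Farey sequence have determinant `1`. -/
lemma FareyConsecutive.sub_eq {N : ℕ} {p q : ℚ} (h : FareyConsecutive N p q) :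
    q - p = 1 / (p.den * q.den) := by
  obtain ⟨⟨hp0, hp1, hpN⟩, ⟨hq0, hq1, hqN⟩, hpq, hno⟩ := h
  set x : ℤ := (p.den : ℤ) with hx
  set r : ℤ := p.num with hr
  set y : ℤ := (q.den : ℤ) with hy
  set s : ℤ := q.num with hs
  have hx0 : 0 < x := by have := p.den_pos; omega
  have hy0 : 0 < y := by have := q.den_pos; omega
  have hpx : p = (r : ℚ) / x := by rw [hr, hx]; exact_mod_cast (Rat.num_div_den p).symm
  have hqy : q = (s : ℚ) / y := by rw [hs, hy]; exact_mod_cast (Rat.num_div_den q).symm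
  have hx0' : (0 : ℚ) < x := by exact_mod_cast hx0
  have hy0' : (0 : ℚ) < y := by exact_mod_cast hy0
  have hr0 : 0 ≤ r := Rat.num_nonneg.mpr hp0
  have hrx : r < x := by
    have : p < 1 := hpq.trans_le hq1
    rw [hpx, div_lt_one hx0'] at this
    exact_mod_cast this
  have hdet : r * y < s * x := by
    rw [hpx, hqy, div_lt_div_iff₀ hx0' hy0'] at hpq
    exact_mod_cast hpq
  obtain ⟨u, v, huv⟩ : IsCoprime r x := by
    rw [Int.isCoprime_iff_nat_coprime]
    exact p.reduced
  -- the solution `(a, c)` of `a x - c r = 1` with the largest `c ≤ N`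
  obtain ⟨a, c, hac, hcN, hcx⟩ : ∃ a c : ℤ, a * x - c * r = 1 ∧ c ≤ N ∧ N < c + x := by
    refine ⟨v + r * ((N + u) / x), -u + x * ((N + u) / x), by linear_combination huv, ?_, ?_⟩
    · have := Int.mul_ediv_self_le (x := N + u) hx0.ne'
      omega
    · have := Int.lt_mul_ediv_self_add (x := N + u) hx0
      omega
  have hc0 : 0 < c := by omega
  have hc0' : (0 : ℚ) < c := by exact_mod_cast hc0
  have hden : (((a : ℚ) / c).den : ℤ) = c := by
    apply Rat.den_div_eq_of_coprime hc0
    rw [← Int.isCoprime_iff_nat_coprime]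
    exact ⟨x, -r, by linear_combination hac⟩
  have ha0 : 0 ≤ a := by nlinarith
  have hac1 : a ≤ c := by nlinarith
  have hsub : (a : ℚ) / c - p = 1 / (x * c) := by
    have : (a : ℚ) * x - c * r = 1 := by exact_mod_cast hac
    rw [hpx]
    field_simp
    linarith
  have hmem : (a : ℚ) / c ∈ fareySet N :=
    ⟨by positivity, by rw [div_le_one hc0']; exact_mod_cast hac1, by omega⟩
  have hlt : p < (a : ℚ) / c := by
    have : 0 < 1 / ((x : ℚ) * c) := by positivity
    linarith
  have hle : q ≤ (a : ℚ) / c := not_lt.mp fun h => hno _ hmem ⟨hlt, h⟩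
  rcases hle.eq_or_lt with heq | hlt'
  · have hyc : y = c := by rw [hy, heq, hden]
    rw [← heq, ← hyc] at hsub
    rw [hsub, hx, hy]
    push_cast
    rfl
  -- otherwise `r / x < s / y < a / c`, and then `y ≥ x + c > N`
  · exfalso
    rw [hqy, div_lt_div_iff₀ hy0' hc0'] at hlt'
    have h1 : s * c < a * y := by exact_mod_cast hlt'
    have h2 : y = x * (a * y - s * c) + c * (s * x - r * y) := by linear_combination -y * hac
    nlinarith

/-- No fraction with denominator `n ≤ N` lies strictly between consecutive terms. -/
lemma FareyConsecutive.ceil_mul_eq {N : ℕ} {p q : ℚ} (h : FareyConsecutive N p q) {n : ℕ}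
    (h1 : 1 ≤ n) (hn : n ≤ N) : ⌈(n : ℚ) * q⌉ = ⌊(n : ℚ) * p⌋ + 1 := by
  obtain ⟨⟨hp0, hp1, hpN⟩, ⟨hq0, hq1, hqN⟩, hpq, hno⟩ := h
  have hn0 : (0 : ℚ) < n := by exact_mod_cast h1
  set m := ⌊(n : ℚ) * p⌋ with hm
  have hm0 : 0 ≤ m := Int.floor_nonneg.mpr (by positivity)
  have hm1 : (n : ℚ) * p < m + 1 := Int.lt_floor_add_one _
  have hm2 : (m : ℚ) ≤ n * p := Int.floor_le _
  apply le_antisymm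
  · rw [Int.ceil_le]
    by_contra! hlt
    push_cast at hlt
    refine hno (((m + 1 : ℤ) : ℚ) / ((n : ℤ) : ℚ)) ⟨by positivity, ?_, ?_⟩ ⟨?_, ?_⟩
    · rw [div_le_one (by exact_mod_cast hn0)]
      push_cast
      nlinarith
    · have := Int.le_of_dvd (by omega) (Rat.den_dvd (m + 1) n)
      have h3 : (((m + 1 : ℤ) : ℚ) / ((n : ℤ) : ℚ)).den = (Rat.divInt (m + 1) n).den := by
        rw [Rat.divInt_eq_div]
      omega
    · rw [lt_div_iff₀ (by exact_mod_cast hn0)]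
      push_cast
      linarith
    · rw [div_lt_iff₀ (by exact_mod_cast hn0)]
      push_cast
      linarith
  · rw [Int.add_one_le_iff, Int.lt_ceil]
    nlinarith

lemma ceil_natCast_mul_eq (n : ℕ) (p : ℚ) :
    ⌈(n : ℚ) * p⌉ = ⌊(n : ℚ) * p⌋ + if p.den ∣ n then 0 else 1 := by
  split_ifs with h
  · obtain ⟨c, rfl⟩ := h
    have : ((p.den * c : ℕ) : ℚ) * p = ((c * p.num : ℤ) : ℚ) := by
      push_cast
      rw [← Rat.mul_den_eq_num p]
      ring
    rw [this, Int.ceil_intCast, Int.floor_intCast, add_zero]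
  · apply le_antisymm (Int.ceil_le_floor_add_one _)
    rw [Int.add_one_le_iff, Int.lt_ceil]
    refine lt_of_le_of_ne (Int.floor_le _) fun heq => h ?_
    have h1 : ((⌊(n : ℚ) * p⌋ * p.den : ℤ) : ℚ) = ((n * p.num : ℤ) : ℚ) := by
      push_cast
      rw [heq, ← Rat.mul_den_eq_num p]
      ring
    have h2 : (p.den : ℤ) ∣ n * p.num := ⟨⌊(n : ℚ) * p⌋, by
      rw [← Int.cast_injective h1]; ring⟩
    have hcop : IsCoprime (p.den : ℤ) p.num := by
      rw [Int.isCoprime_iff_nat_coprime]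
      exact p.reduced.symm
    exact_mod_cast hcop.dvd_of_dvd_mul_right h2

/-- The odd, `1`-periodic sawtooth function, equal to `u - ⌊u⌋ - 1/2` off the integers and to `0` on
the integers. -/
def sawtooth (u : ℚ) : ℚ := u - (⌊u⌋ + ⌈u⌉) / 2

lemma sawtooth_neg (u : ℚ) : sawtooth (-u) = -sawtooth u := by
  simp only [sawtooth, Int.floor_neg, Int.ceil_neg]
  push_cast
  ring

lemma sawtooth_sub_intCast (u : ℚ) (m : ℤ) : sawtooth (u - m) = sawtooth u := by
  simp only [sawtooth, Int.floor_sub_intCast, Int.ceil_sub_intCast]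
  push_cast
  ring

/-- Between consecutive Farey fractions `p < q` the step part of `sawtooth (n t)` is constant, with
half a jump at `p` when `p.den ∣ n` and half a jump at `q` when `q.den ∣ n`. -/
lemma FareyConsecutive.sawtooth_sub {N : ℕ} {p q : ℚ} (h : FareyConsecutive N p q) {n : ℕ}
    (h1 : 1 ≤ n) (hn : n ≤ N) :
    sawtooth (n * q) - sawtooth (n * p) =
      n * (q - p) - ((if p.den ∣ n then 1 else 0) + if q.den ∣ n then 1 else 0) / 2 := by
  have e1 := ceil_natCast_mul_eq n p
  have e2 := ceil_natCast_mul_eq n q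
  have e3 := h.ceil_mul_eq h1 hn
  have e4 : ⌊(n : ℚ) * q⌋ = ⌊(n : ℚ) * p⌋ + if q.den ∣ n then 1 else 0 := by
    split_ifs at * <;> omega
  simp only [sawtooth]
  rw [e3, e1, e4]
  push_cast
  split_ifs <;> ring

namespace RootPairing.Base

open Module Set

set_option linter.unusedSectionVars false

variable {ι V V' : Type*} [AddCommGroup V] [Module ℝ V] [AddCommGroup V'] [Module ℝ V']
  {P : RootPairing ι ℝ V V'} [Fintype ι] [Nonempty ι] [P.IsRootSystem] [P.IsCrystallographic]
  [P.IsReduced] [P.IsIrreducible]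

/-- The vector `∑ ((n_β p)) β`, where `n_β` is the level of `β`, is a multiple of `ϖ_α`, and it is
also killed by the coroot of a root `γ` of level `p.den`: the reflection in `γ` changes each `n_β p`
by an integer. Since `ϖ_α` does not vanish on `γ^∨`, the vector is zero. -/
lemma sum_sawtooth_smul_root (b : P.Base) (α : b.support) {p : ℚ}
    (hp : p.den ≤ (b.coeffH α).toNat) :
    ∑ i, ((sawtooth (b.rootCoeff i α * p) : ℚ) : ℝ) • P.root i = 0 := by
  have hden := p.den_pos
  obtain ⟨γ, hγ⟩ := b.exists_rootCoeff_eq α (k := p.den) (by omega) (by omega)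
  have h1 := b.sum_smul_root_eq_smul_fundWeight α (fun n => ((sawtooth (n * p) : ℚ) : ℝ))
  have h2 := toLinearMap_sum_smul_root_coroot_eq_zero P
    (fun i => ((sawtooth (b.rootCoeff i α * p) : ℚ) : ℝ)) γ fun i => by
      rw [rootCoeff_reflectionPerm, hγ]
      have : ((b.rootCoeff i α - P.pairingIn ℤ i γ * (p.den : ℤ) : ℤ) : ℚ) * p =
          b.rootCoeff i α * p - ((P.pairingIn ℤ i γ * p.num : ℤ) : ℚ) := by
        push_cast
        rw [← Rat.mul_den_eq_num p]
        ring
      rw [this, sawtooth_sub_intCast]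
  have h3 : (b.corootCoeff γ α : ℝ) ≠ 0 := by
    intro h0
    have h := b.corootForm_mul_rootCoeff α γ
    have hpos : (0 : ℝ) < b.rootCoeff γ α := by rw [hγ]; exact_mod_cast hden
    rw [h0, mul_zero] at h
    exact (mul_pos (corootForm_coroot_self_pos P γ) hpos).ne' h
  beta_reduce at h1
  rw [h1, map_smul, LinearMap.smul_apply, fundWeight_apply_coroot_eq_corootCoeff, smul_eq_mul,
    mul_eq_zero, or_iff_left h3] at h2
  rw [h1, h2, zero_smul]

lemma sum_levelIndex_mul_sawtooth (b : P.Base) (α : b.support) {p : ℚ}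
    (hp : p.den ≤ (b.coeffH α).toNat) :
    ∑ n ∈ Finset.Icc 1 (b.coeffH α).toNat,
      b.levelIndex α n * ((sawtooth (n * p) : ℚ) : ℝ) = 0 := by
  have h1 := congrArg (fun v => P.toLinearMap v (b.fundCoweight α)) (b.sum_sawtooth_smul_root α hp)
  simp only [map_sum, map_smul, LinearMap.sum_apply, LinearMap.smul_apply, smul_eq_mul,
    root_apply_fundCoweight_eq_rootCoeff, map_zero, LinearMap.zero_apply] at h1
  have h2 := b.sum_rootCoeff_eq_sum_levelCard α
    (fun n => ((sawtooth (n * p) : ℚ) : ℝ) * n)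
    (fun n => by push_cast; rw [neg_mul, sawtooth_neg]; push_cast; ring) (by simp)
  rw [h1] at h2
  have h3 : ∑ n ∈ Finset.Icc 1 (b.coeffH α).toNat,
      b.levelIndex α n * ((sawtooth (n * p) : ℚ) : ℝ) =
      (∑ n ∈ Finset.Icc 1 (b.coeffH α).toNat,
        b.levelCard α n * (((sawtooth (((n : ℤ) : ℚ) * p) : ℚ) : ℝ) * ((n : ℤ) : ℝ))) /
        P.toLinearMap (b.fundWeight α) (b.fundCoweight α) := by
    rw [Finset.sum_div]
    refine Finset.sum_congr rfl fun n _ => ?_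
    rw [levelIndex]
    push_cast
    ring
  rw [h3, div_eq_zero_iff]
  left
  linarith

/-! ### Circular symmetry -/

lemma dSeq_eq_sum (b : P.Base) (α : b.support) {k : ℕ} (hk : 0 < k) :
    b.dSeq α k = ∑ n ∈ Finset.Icc 1 (b.coeffH α).toNat with k ∣ n, b.levelIndex α n := by
  have hinj : Function.Injective fun ℓ : ℕ+ => (ℓ : ℕ) * k := fun x y h =>
    PNat.coe_injective (Nat.eq_of_mul_eq_mul_right hk h)
  rw [dSeq, ← finsum_mem_range (f := b.levelIndex α) hinj]
  apply finsum_mem_eq_sum_of_inter_support_eq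
  ext n
  simp only [Set.mem_inter_iff, Set.mem_range, Function.mem_support, Finset.coe_filter,
    Finset.mem_Icc, Set.mem_ofPred_eq]
  refine and_congr_left fun hn => ⟨?_, ?_⟩
  · rintro ⟨ℓ, rfl⟩
    exact ⟨⟨Nat.mul_pos ℓ.pos hk, not_lt.mp fun h => hn (b.levelIndex_eq_zero α h)⟩,
      Dvd.intro_left _ rfl⟩
  · rintro ⟨⟨h1, -⟩, c, rfl⟩
    exact ⟨⟨c, Nat.pos_of_mul_pos_left h1⟩, mul_comm _ _⟩

lemma exists_dSeq_eq_natCast (b : P.Base) (α : b.support) {k : ℕ} (h1 : 1 ≤ k)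
    (hk : k ≤ (b.coeffH α).toNat) : ∃ m : ℕ, 0 < m ∧ b.dSeq α k = m := by
  have hpos : 0 < b.dSeq α k := by
    rw [dSeq_eq_sum b α h1]
    refine Finset.sum_pos' (fun n _ => b.levelIndex_nonneg α n) ⟨k, ?_, b.levelIndex_pos α h1 hk⟩
    simp [h1, hk]
  obtain ⟨z, hz⟩ : ∃ z : ℤ, b.dSeq α k = z := by
    refine ⟨∑ n ∈ Finset.Icc 1 (b.coeffH α).toNat with k ∣ n,
      ∑ i with b.rootCoeff i α = n, P.pairingIn ℤ i α, ?_⟩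
    rw [dSeq_eq_sum b α h1, Int.cast_sum]
    exact Finset.sum_congr rfl fun n _ => b.levelIndex_eq_sum α n
  rw [hz] at hpos ⊢
  have hz0 : 0 < z := by exact_mod_cast hpos
  lift z to ℕ using hz0.le
  exact ⟨z, by exact_mod_cast hz0, by simp⟩

lemma sum_totient_mul_dSeq (b : P.Base) (α : b.support) :
    ∑ k ∈ Finset.Icc 1 (b.coeffH α).toNat, (Nat.totient k : ℝ) * b.dSeq α k =
      ∑ n ∈ Finset.Icc 1 (b.coeffH α).toNat, n * b.levelIndex α n := by
  calc ∑ k ∈ Finset.Icc 1 (b.coeffH α).toNat, (Nat.totient k : ℝ) * b.dSeq α k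
      = ∑ k ∈ Finset.Icc 1 (b.coeffH α).toNat, ∑ n ∈ Finset.Icc 1 (b.coeffH α).toNat with k ∣ n,
          (Nat.totient k : ℝ) * b.levelIndex α n := by
        refine Finset.sum_congr rfl fun k hk => ?_
        rw [dSeq_eq_sum b α (Finset.mem_Icc.mp hk).1, Finset.mul_sum]
    _ = ∑ n ∈ Finset.Icc 1 (b.coeffH α).toNat, ∑ k ∈ n.divisors,
          (Nat.totient k : ℝ) * b.levelIndex α n := by
        refine Finset.sum_comm' fun k n => ?_
        simp only [Finset.mem_filter, Finset.mem_Icc, Nat.mem_divisors]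
        refine ⟨fun ⟨_, hn, hd⟩ => ⟨⟨hd, by omega⟩, hn⟩, fun ⟨⟨hd, _⟩, hn⟩ => ⟨⟨?_, ?_⟩, hn, hd⟩⟩
        · exact Nat.pos_of_dvd_of_pos hd hn.1
        · exact (Nat.le_of_dvd hn.1 hd).trans hn.2
    _ = _ := by
        refine Finset.sum_congr rfl fun n _ => ?_
        rw [← Finset.sum_mul, ← Nat.cast_sum, Nat.sum_totient]

lemma dSeq_add_dSeq (b : P.Base) (α : b.support) {p q : ℚ}
    (h : FareyConsecutive (b.coeffH α).toNat p q) :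
    b.dSeq α p.den + b.dSeq α q.den =
      2 * ((b.dualCoxeterNumber : ℝ) * b.coeffH α / b.coeffG α) /
        ((p.den : ℝ) * (q.den : ℝ)) := by
  have hsub : (q : ℝ) - p = 1 / ((p.den : ℝ) * (q.den : ℝ)) := by
    simpa using congrArg (Rat.cast : ℚ → ℝ) h.sub_eq
  have hp := b.sum_levelIndex_mul_sawtooth α h.1.2.2
  have hq := b.sum_levelIndex_mul_sawtooth α h.2.1.2.2
  have hdiff : ∑ n ∈ Finset.Icc 1 (b.coeffH α).toNat, b.levelIndex α n *
      ((sawtooth (n * q) : ℚ) : ℝ) - ∑ n ∈ Finset.Icc 1 (b.coeffH α).toNat, b.levelIndex α n *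
      ((sawtooth (n * p) : ℚ) : ℝ) =
      (∑ n ∈ Finset.Icc 1 (b.coeffH α).toNat, n * b.levelIndex α n) * ((q : ℝ) - p) -
        (b.dSeq α p.den + b.dSeq α q.den) / 2 := by
    rw [dSeq_eq_sum b α p.den_pos, dSeq_eq_sum b α q.den_pos, Finset.sum_filter,
      Finset.sum_filter, ← Finset.sum_sub_distrib, ← Finset.sum_add_distrib, Finset.sum_mul,
      Finset.sum_div, ← Finset.sum_sub_distrib]
    refine Finset.sum_congr rfl fun n hn => ?_
    rw [Finset.mem_Icc] at hn
    have e := congrArg (Rat.cast : ℚ → ℝ) (h.sawtooth_sub hn.1 hn.2)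
    push_cast at e
    rw [← mul_sub, e]
    split_ifs <;> ring
  rw [hp, hq, sum_mul_levelIndex, hsub] at hdiff
  rw [mul_one_div] at hdiff
  rw [mul_div_assoc]
  linarith

end RootPairing.Base

theorem proposition1 {ι V V' : Type*} [Finite ι] [Nonempty ι]
    [AddCommGroup V] [Module ℝ V] [AddCommGroup V'] [Module ℝ V']
    (P : RootPairing ι ℝ V V') [P.IsRootSystem] [P.IsCrystallographic] [P.IsReduced]
    [P.IsIrreducible] (b : P.Base) (α : b.support) :
    HasCircularSymmetry (b.dSeq α) (b.coeffH α).toNat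
      ((b.dualCoxeterNumber : ℝ) * (b.coeffH α : ℝ) / (b.coeffG α : ℝ)) := by
  cases nonempty_fintype ι
  exact
    { pos_integer := fun k h1 hk => b.exists_dSeq_eq_natCast α h1 hk
      sum_totient := by rw [b.sum_totient_mul_dSeq, b.sum_mul_levelIndex]
      add_eq := fun p q h => b.dSeq_add_dSeq α h }
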